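/- Let $N\ge 0$, let $H=L^2([0,1];\mathbb C^N)$ and $\hat H=H\oplus H$ with $J(x,y)=(y,-x)$. A subspace $L\subset\hat H$ is lagrangian if $JL=L^\perp$. The set $\mathrm{Lag}$ of lagrangians carries the topology induced by the operator norm through $L\mapsto R_L=2P_L-1$ ($P_L$ the orthogonal projection onto $L$), and the Arnold charts $S\mapsto\{v+JSv: v\in L_0\}$, with $S$ a bounded self-adjoint operator on a lagrangian $L_0$. Let $\mathrm{Lag}^-\subset\mathrm{Lag}$ be the subspace of those $L$ for which $L\cap H^-$ is finite dimensional and $L+H^-$ is closed, where $H^-=0\oplus H$. The unitary group $U(N)$ carries the charts inverse to $A\mapsto (i-A)(i+A)^{-1}U_0$, with $A$ self-adjoint on $\mathbb C^N$ and $U_0\in U(N)$. For $U\in U(N)$ let $L^{1,2}_U$ be the completion of $\{f\in C^\infty([0,1];\mathbb C^N): f(1)=Uf(0)\}$ in the norm $\left(\int_0^1|f'|^2+|f|^2\,dt\right)^{1/2}$, viewed as a subspace of $H$, and let $T_U=-i\,\frac{d}{dt}$ be the resulting unbounded operator on $H$ with domain $L^{1,2}_U$. Then, for every $U\in U(N)$,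 the switched graph $\{(T_Uf,f): f\in L^{1,2}_U\}$ belongs to $\mathrm{Lag}^-$, and the universal family $$T:U(N)\to\mathrm{Lag}^-,\qquad U\mapsto\{(T_Uf,f): f\in L^{1,2}_U\},$$ is differentiable, indeed continuous and of class $C^\infty$ in the charts above. Moreover, $T$ is homotopic, through continuous maps $U(N)\to\mathrm{Lag}^-$, to the (well-defined and continuous) inclusion $U(N)\hookrightarrow\mathrm{Lag}^-$ given by the Arnold isomorphism, $$U\mapsto\{((1+\hat U)v,\,-i(1-\hat U)v): v\in H\},$$ where $\hat U$ is the unitary operator on $H$ that acts as $U$ on the constant functions $\mathbb C^N\subset H$ and as the identity on their orthogonal complement. -/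

import Mathlib

open MeasureTheory
open scoped ContDiff

noncomputable section

namespace LagGrass

section Grassmannian

variable (H : Type*) [NormedAddCommGroup H] [InnerProductSpace ℂ H]

/-- The Hilbert space `Ĥ = H ⊕ H` (with the `ℓ²` norm). -/
abbrev Hhat : Type _ := WithLp 2 (H × H)

/-- The complex structure `J (x, y) = (y, -x)` of `Ĥ`, as a continuous linear map. -/
def J : Hhat H →L[ℂ] Hhat H :=
  (WithLp.prodContinuousLinearEquiv 2 ℂ H H).symm.toContinuousLinearMap ∘L
    ((ContinuousLinearMap.snd ℂ H H).prod (-(ContinuousLinearMap.fst ℂ H H))) ∘L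
      (WithLp.prodContinuousLinearEquiv 2 ℂ H H).toContinuousLinearMap

@[simp] theorem J_apply (p : Hhat H) : J H p = WithLp.toLp 2 (p.snd, -p.fst) := rfl

theorem J_J (p : Hhat H) : J H (J H p) = -p := by
  apply (WithLp.equiv 2 (H × H)).injective
  simp [Prod.ext_iff]

/-- The vertical subspace `H⁻ = 0 ⊕ H`. -/
def vertical : Submodule ℂ (Hhat H) where
  carrier := {p | p.fst = 0}
  add_mem' := by
    intro a b ha hb
    simp only [Set.mem_ofPred_eq] at ha hb ⊢
    simp [ha, hb]
  zero_mem' := by simp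
  smul_mem' := by
    intro c a ha
    simp only [Set.mem_ofPred_eq] at ha ⊢
    simp [ha]

/-- A subspace `L` of `Ĥ` is lagrangian if `J L = L^⊥`. -/
def IsLagrangian (L : Submodule ℂ (Hhat H)) : Prop :=
  L.map (J H : Hhat H →ₗ[ℂ] Hhat H) = Lᗮ

/-- The (hermitian) Lagrangian Grassmannian of `Ĥ`. -/
def Lag : Type _ := {L : Submodule ℂ (Hhat H) // IsLagrangian H L}

variable {H}

/-- The subspace underlying a point of the Lagrangian Grassmannian. -/
def Lag.space (L : Lag H) : Submodule ℂ (Hhat H) := L.1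

theorem Lag.isClosed (L : Lag H) : IsClosed (L.space : Set (Hhat H)) := by
  have h : (L.space : Set (Hhat H)) = J H ⁻¹' (L.spaceᗮ : Set (Hhat H)) := by
    ext p
    have hL : L.space.map (J H : Hhat H →ₗ[ℂ] Hhat H) = L.spaceᗮ := L.2
    rw [← hL]
    constructor
    · intro hp
      exact ⟨p, hp, rfl⟩
    · rintro ⟨q, hq, hqp⟩
      have h1 : J H (J H q) = J H (J H p) := congrArg (J H) hqp
      rw [J_J, J_J, neg_inj] at h1
      rw [← h1]
      exact hq
  rw [h]
  exact (Submodule.isClosed_orthogonal _).preimage (J H).continuous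

/-- A pair of subspaces is a Fredholm pair if its intersection is finite dimensional and its sum
is closed (for lagrangians the condition on orthogonal complements is automatic). -/
def IsFredholmPair (L₁ L₂ : Submodule ℂ (Hhat H)) : Prop :=
  FiniteDimensional ℂ ↥(L₁ ⊓ L₂) ∧ IsClosed ((L₁ ⊔ L₂ : Submodule ℂ (Hhat H)) : Set (Hhat H))

variable [CompleteSpace H]

instance (L : Lag H) : L.space.HasOrthogonalProjection :=
  haveI : CompleteSpace L.space := L.isClosed.completeSpace_coe
  inferInstance

/-- The orthogonal reflection `R_L = 2 P_L - 1` in a lagrangian. -/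
def Lag.refl (L : Lag H) : Hhat H →L[ℂ] Hhat H :=
  (2 : ℂ) • L.space.starProjection - ContinuousLinearMap.id ℂ (Hhat H)

/-- `Lag` carries the topology induced from the operator norm by `L ↦ R_L`. -/
instance : TopologicalSpace (Lag H) := TopologicalSpace.induced Lag.refl inferInstance

variable (H) in
/-- The space `Lag⁻` of vertical, Fredholm lagrangians, with the subspace topology. -/
abbrev LagMinus : Type _ := {L : Lag H // IsFredholmPair L.space (vertical H)}

/-- The graph `{v + J S v | v ∈ L}` of `J S : L → L^⊥`; the Arnold chart around `L` sends a
self-adjoint bounded operator `S` of `L` to this lagrangian. -/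
def arnoldGraph (L : Lag H) (S : L.space →L[ℂ] L.space) : Submodule ℂ (Hhat H) :=
  LinearMap.range ((L.space.subtypeL + J H ∘L L.space.subtypeL ∘L S : L.space →L[ℂ] Hhat H) :
    L.space →ₗ[ℂ] Hhat H)

/-- The Cayley graph `{((1 + V) v, -i (1 - V) v) | v ∈ H}` of an operator `V`. On unitary operators
this is the Arnold isomorphism. -/
def cayleyGraph (V : H →L[ℂ] H) : Submodule ℂ (Hhat H) :=
  LinearMap.range (((WithLp.prodContinuousLinearEquiv 2 ℂ H H).symm.toContinuousLinearMap ∘L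
    ((1 + V).prod (-(Complex.I • (1 - V)))) : H →L[ℂ] Hhat H) : H →ₗ[ℂ] Hhat H)

/-- The switched graph `{(T w, w) | w ∈ D(T)}` of an unbounded operator `T`. -/
def switchedGraph (T : H →ₗ.[ℂ] H) : Submodule ℂ (Hhat H) where
  carrier := {p | ∃ w : T.domain, p = WithLp.toLp 2 (T w, (w : H))}
  add_mem' := by
    rintro _ _ ⟨v, rfl⟩ ⟨w, rfl⟩
    exact ⟨v + w, by rw [T.map_add]; rfl⟩
  zero_mem' := ⟨0, by rw [T.map_zero]; rfl⟩
  smul_mem' := by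
    rintro c _ ⟨w, rfl⟩
    exact ⟨c • w, by rw [T.map_smul]; rfl⟩

end Grassmannian

section Smooth

variable {E : Type*} [NormedAddCommGroup E] [InnerProductSpace ℂ E] [CompleteSpace E]

/-- The real Banach space `Sym(E)` of bounded self-adjoint operators. -/
abbrev Sym (E : Type*) [NormedAddCommGroup E] [InnerProductSpace ℂ E] [CompleteSpace E] :
    Submodule ℝ (E →L[ℂ] E) := selfAdjoint.submodule ℝ (E →L[ℂ] E)

/-- `(i - A) (i + A)⁻¹`, for `A` self-adjoint. -/
def cayley (A : E →L[ℂ] E) : E →L[ℂ] E :=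
  (algebraMap ℂ (E →L[ℂ] E) Complex.I - A) * Ring.inverse (algebraMap ℂ (E →L[ℂ] E) Complex.I + A)

theorem isUnit_I_add {A : E →L[ℂ] E} (hA : IsSelfAdjoint A) :
    IsUnit (algebraMap ℂ (E →L[ℂ] E) Complex.I + A) := by
  have h : (-Complex.I) ∉ spectrum ℂ A := by
    intro h
    have := hA.im_eq_zero_of_mem_spectrum h
    simp at this
  have h2 := (spectrum.notMem_iff.mp h).neg
  simpa [add_comm] using h2

theorem cayley_mem_unitary {A : E →L[ℂ] E} (hA : IsSelfAdjoint A) :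
    cayley A ∈ unitary (E →L[ℂ] E) := by
  obtain ⟨u, hu⟩ := isUnit_I_add hA
  set i : E →L[ℂ] E := algebraMap ℂ (E →L[ℂ] E) Complex.I with hi
  have hstar : star i = -i := by
    rw [hi, ← algebraMap_star_comm]
    simp
  have hcomm : Commute i A := Algebra.commutes _ _
  have hv : star ((u : E →L[ℂ] E)) = -(i - A) := by
    rw [hu, star_add, hstar, hA.star_eq]
    abel
  have hw : i - A = -star ((u : E →L[ℂ] E)) := by rw [hv, neg_neg]
  have hcu : Commute (star (u : E →L[ℂ] E)) (u : E →L[ℂ] E) := by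
    rw [hv, hu]
    exact (((Commute.refl i).sub_left hcomm.symm).add_right
      (hcomm.sub_left (Commute.refl A))).neg_left
  have hc : cayley A = -(star (u : E →L[ℂ] E) * ((u⁻¹ : (E →L[ℂ] E)ˣ) : E →L[ℂ] E)) := by
    rw [cayley, ← hi, hw, ← hu, Ring.inverse_unit, neg_mul]
  have hsi : star ((u⁻¹ : (E →L[ℂ] E)ˣ) : E →L[ℂ] E) =
      (((star u)⁻¹ : (E →L[ℂ] E)ˣ) : E →L[ℂ] E) := by
    rw [← Units.coe_star, star_inv]
  have hcu' : Commute (star u) u := by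
    ext1
    simpa using hcu.eq
  have key : star (cayley A) = -(((u * (star u)⁻¹ : (E →L[ℂ] E)ˣ)) : E →L[ℂ] E) := by
    rw [hc, star_neg, star_mul, star_star, hsi, Units.val_mul]
    congr 1
    exact congrArg Units.val (hcu'.inv_left).eq
  have key2 : cayley A = -((star u * u⁻¹ : (E →L[ℂ] E)ˣ) : E →L[ℂ] E) := by
    rw [hc, Units.val_mul, Units.coe_star]
  rw [Unitary.mem_iff, key, key2, neg_mul_neg, neg_mul_neg, ← Units.val_mul, ← Units.val_mul]
  constructor
  · rw [show u * (star u)⁻¹ * (star u * u⁻¹) = 1 by group, Units.val_one]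
  · rw [show star u * u⁻¹ * (u * (star u)⁻¹) = 1 by group, Units.val_one]

/-- The inverse of the Arnold chart (Cayley chart) around a unitary operator `U₀`: the chart is
`U ↦ i (1 - U U₀⁻¹) (1 + U U₀⁻¹)⁻¹`, with inverse `A ↦ (i - A) (i + A)⁻¹ U₀`, defined on the whole
of `Sym(E)`. -/
def cayleyChart (U₀ : unitary (E →L[ℂ] E)) (A : Sym E) : unitary (E →L[ℂ] E) :=
  ⟨cayley (A : E →L[ℂ] E), cayley_mem_unitary A.2⟩ * U₀

/-- A map `F` from the unitary group of `E` to `Lag` is smooth (`C^∞`) if it is continuous and its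
expression `S` in every pair consisting of an Arnold chart around some `U₀` and an Arnold chart
around some lagrangian `L₀` is smooth at every point where it is defined. -/
def IsSmoothFamily {H : Type*} [NormedAddCommGroup H] [InnerProductSpace ℂ H] [CompleteSpace H]
    (F : unitary (E →L[ℂ] E) → Lag H) : Prop :=
  Continuous F ∧
  ∀ (U₀ : unitary (E →L[ℂ] E)) (L₀ : Lag H), ∃ S : Sym E → (L₀.space →L[ℂ] L₀.space),
    ∀ A : Sym E,
      (∃ S' : L₀.space →L[ℂ] L₀.space, (S' : L₀.space →ₗ[ℂ] L₀.space).IsSymmetric ∧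
        (F (cayleyChart U₀ A)).space = arnoldGraph L₀ S') →
      (S A : L₀.space →ₗ[ℂ] L₀.space).IsSymmetric ∧
        (F (cayleyChart U₀ A)).space = arnoldGraph L₀ (S A) ∧ ContDiffAt ℝ ∞ S A

end Smooth

section Universal

variable (N : ℕ)

/-- `ℂ^N` with its hermitian inner product. -/
abbrev CN : Type := EuclideanSpace ℂ (Fin N)

/-- The unitary group `U(N)`, as the group of unitary operators of `ℂ^N`. -/
abbrev UN : Type := unitary (CN N →L[ℂ] CN N)

/-- Lebesgue measure on `[0,1]`. -/
abbrev leb : Measure ℝ := volume.restrict (Set.Icc (0 : ℝ) 1)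

/-- The Hilbert space `L²([0,1]; ℂ^N)`. -/
abbrev L2 : Type := Lp (CN N) 2 leb

variable {N}

/-- The graph `{(f, -i f') | f ∈ C^∞_U}` in `L² × L²`, where `C^∞_U` is the space of smooth
`f : [0,1] → ℂ^N` with `f(1) = U f(0)`. -/
def smoothGraph (U : UN N) : Submodule ℂ (L2 N × L2 N) where
  carrier := {p | ∃ f : ℝ → CN N, ContDiffOn ℝ ∞ f (Set.Icc 0 1) ∧
    f 1 = (U : CN N →L[ℂ] CN N) (f 0) ∧ p.1 =ᵐ[leb] f ∧
    p.2 =ᵐ[leb] fun t => -(Complex.I • derivWithin f (Set.Icc 0 1) t)}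
  add_mem' := by
    rintro p q ⟨f, hf, hf1, hpf, hpf'⟩ ⟨g, hg, hg1, hqg, hqg'⟩
    refine ⟨f + g, hf.add hg, by simp [hf1, hg1], ?_, ?_⟩
    · exact (Lp.coeFn_add p.1 q.1).trans (hpf.add hqg)
    · refine (Lp.coeFn_add p.2 q.2).trans ?_
      filter_upwards [hpf', hqg', ae_restrict_mem measurableSet_Icc] with t h1 h2 ht
      rw [Pi.add_apply, h1, h2, derivWithin_add
        (hf.differentiableOn (by simp) t ht) (hg.differentiableOn (by simp) t ht), smul_add,
        neg_add]
  zero_mem' := by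
    refine ⟨0, contDiffOn_const, by simp, Lp.coeFn_zero _ _ _, ?_⟩
    refine (Lp.coeFn_zero _ _ _).trans ?_
    filter_upwards with t
    simp
  smul_mem' := by
    rintro c p ⟨f, hf, hf1, hpf, hpf'⟩
    refine ⟨c • f, hf.const_smul c, by simp [hf1], ?_, ?_⟩
    · exact (Lp.coeFn_smul c p.1).trans (hpf.const_smul c)
    · refine (Lp.coeFn_smul c p.2).trans ?_
      filter_upwards [hpf', ae_restrict_mem measurableSet_Icc] with t h1 ht
      rw [Pi.smul_apply, h1, derivWithin_const_smul c (hf.differentiableOn (by simp) t ht),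
        smul_neg, smul_comm]

/-- The operator `T_U = -i d/dt` on `L^{1,2}_U([0,1])`, as an unbounded operator of `L²`. The space
`L^{1,2}_U` is the completion of `C^∞_U` in the norm `(‖f'‖² + ‖f‖²)^(1/2)`, which is the graph norm
of `-i d/dt`; so the graph of `T_U` is the closure in `L² × L²` of the graph of `-i d/dt` on
`C^∞_U`. -/
def diracOp (U : UN N) : L2 N →ₗ.[ℂ] L2 N :=
  (smoothGraph U).topologicalClosure.toLinearPMap

variable (N) in
/-- The isometric embedding of `ℂ^N` in `L²([0,1]; ℂ^N)` as the constant functions. -/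
def const : CN N →L[ℂ] L2 N := Lp.constL 2 leb ℂ

/-- The extension of `U` to `L²([0,1]; ℂ^N)`: it acts as `U` on the constant functions and as the
identity on their orthogonal complement. -/
def extendByOne (U : UN N) : L2 N →L[ℂ] L2 N :=
  const N ∘L (U : CN N →L[ℂ] CN N) ∘L (const N).adjoint + (1 - const N ∘L (const N).adjoint)

end Universal

end LagGrass

end

/-!
The proof rests on an explicit normal form of the lagrangians `{(T_U f, f)}`.

Let `c : ℂ^N → H` be the inclusion of the constants, `D` the Volterra operator `h ↦ ∫₀ᵗ h` and
`P = c c^*`. Writing `h = f'` and `x = f(0)`, the graph of `T_U` becomes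
`{(-i h, D h + c x) | c^* h = U x - x}` (`mem_switchedGraph_diracOp`; this uses the density of
smooth functions, and Lebesgue's differentiation theorem to see that the closure of the smooth
graph is a graph). Integration by parts says `D + D^* = P` (`inner_volterra_add`), so
`B = i (D - P / 2)` is bounded and self-adjoint. Subtracting `B` of the first component from the
second one leaves `{(-i h, c (U + 1) x / 2) | c^* h = (U - 1) x}`, which is the Cayley graph of the
operator acting as the Blaschke factor `M = (U - 1/3) (U/3 - 1)⁻¹` on the constants and as the
identity on their complement. Hence (`switchedGraph_diracOp`) the lagrangian of `T_U` is the image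
of the Cayley graph of the extension of `M` under the shear `(x, y) ↦ (x, y + B x)`.

Shears along self-adjoint operators are symplectic and fix `H⁻`, so they act on `Lag` and on `Lag⁻`
(`IsLagrangian.map_shearEquiv`, `IsFredholmPair.map_shearEquiv`). The homotopy to the Arnold
inclusion scales the shear to zero while the Blaschke factor `(U - s) (s U - 1)⁻¹` is deformed to
`-U` by letting `s` tend to `0`, and then to `U` by a phase (`blaschkePath`, `diracHomotopy`).

All these lagrangians are ranges of operators `j` that have a left inverse and depend continuously,
or smoothly, on the parameters. The projection onto such a range is `j (j^* j)⁻¹ j^*`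
(`starProjection_range`), which gives continuity; in an Arnold chart the range has the coordinate
`b a⁻¹`, for `a` and `b` the components of `j` (`isInvertible_and_eq_of_range_eq_arnoldGraph`),
which gives smoothness.
-/

noncomputable section

namespace LagGrass

/-! ### Lagrangians, Cayley graphs and shears -/

section Shear

variable {H : Type*} [NormedAddCommGroup H] [InnerProductSpace ℂ H]

theorem inner_J (p q : Hhat H) :
    inner ℂ (J H p) q = inner ℂ p.snd q.fst - inner ℂ p.fst q.snd := by
  rw [J_apply, WithLp.prod_inner_apply, sub_eq_add_neg, ← inner_neg_left]
  rfl

theorem inner_J_J (p q : Hhat H) : inner ℂ (J H p) (J H q) = inner ℂ p q := by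
  simp [add_comm]

/-- A subspace is lagrangian if and only if it is its own annihilator for the sesquilinear
symplectic form `(p, q) ↦ ⟨J p, q⟩`. -/
theorem isLagrangian_iff_forall_mem_iff {L : Submodule ℂ (Hhat H)} :
    IsLagrangian H L ↔ ∀ q, q ∈ L ↔ ∀ p ∈ L, inner ℂ (J H p) q = 0 := by
  constructor
  · intro hL q
    have h1 : q ∈ L ↔ J H q ∈ Lᗮ := by
      rw [← hL]
      refine ⟨fun hq => ⟨q, hq, rfl⟩, ?_⟩
      rintro ⟨p, hp, hpq⟩
      have h2 : J H (J H p) = J H (J H q) := congrArg (J H) hpq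
      rw [J_J, J_J, neg_inj] at h2
      exact h2 ▸ hp
    rw [h1, Submodule.mem_orthogonal]
    refine forall₂_congr fun p _ => ?_
    rw [← inner_J_J, J_J, inner_neg_right, neg_eq_zero]
  · intro h
    apply le_antisymm
    · rintro _ ⟨p, hp, rfl⟩ q hq
      have := (h p).1 hp q hq
      rw [← inner_J_J, ContinuousLinearMap.coe_coe, J_J, inner_neg_right, this, neg_zero]
    · intro q hq
      refine ⟨-J H q, ?_, by rw [ContinuousLinearMap.coe_coe, map_neg, J_J, neg_neg]⟩
      rw [SetLike.mem_coe, h]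
      intro p hp
      rw [inner_neg_right, inner_J_J, hq p hp, neg_zero]

/-- The isomorphism `v ↦ ((1 + V) v, -i (1 - V) v)` of `H` onto the Cayley graph of `V`. -/
def cayleyEmbedding (V : H →L[ℂ] H) : H →L[ℂ] Hhat H :=
  (WithLp.prodContinuousLinearEquiv 2 ℂ H H).symm.toContinuousLinearMap ∘L
    ((1 + V).prod (-(Complex.I • (1 - V))))

@[simp] theorem fst_cayleyEmbedding (V : H →L[ℂ] H) (v : H) :
    (cayleyEmbedding V v).fst = v + V v := rfl

@[simp] theorem snd_cayleyEmbedding (V : H →L[ℂ] H) (v : H) :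
    (cayleyEmbedding V v).snd = -(Complex.I • (v - V v)) := rfl

theorem mem_cayleyGraph {V : H →L[ℂ] H} {p : Hhat H} :
    p ∈ cayleyGraph V ↔ ∃ v, v + V v = p.fst ∧ -(Complex.I • (v - V v)) = p.snd := by
  refine exists_congr fun v => ?_
  rw [← Prod.mk.injEq]
  exact (WithLp.equiv 2 (H × H)).injective.eq_iff.symm

/-- The shear `(x, y) ↦ (x, y + B x)` of `Ĥ`. -/
def shear (B : H →L[ℂ] H) : Hhat H →L[ℂ] Hhat H :=
  1 + (WithLp.prodContinuousLinearEquiv 2 ℂ H H).symm.toContinuousLinearMap ∘L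
    (ContinuousLinearMap.inr ℂ H H) ∘L B ∘L (WithLp.fstL 2 ℂ H H)

theorem shear_apply (B : H →L[ℂ] H) (p : Hhat H) :
    shear B p = WithLp.toLp 2 (p.fst, p.snd + B p.fst) := by
  apply (WithLp.equiv 2 (H × H)).injective
  simp [shear, Prod.ext_iff]

@[simp] theorem fst_shear (B : H →L[ℂ] H) (p : Hhat H) : (shear B p).fst = p.fst := by
  rw [shear_apply]
  rfl

@[simp] theorem snd_shear (B : H →L[ℂ] H) (p : Hhat H) :
    (shear B p).snd = p.snd + B p.fst := by
  rw [shear_apply]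
  rfl

theorem shear_shear_neg (B : H →L[ℂ] H) (p : Hhat H) : shear B (shear (-B) p) = p := by
  apply (WithLp.equiv 2 (H × H)).injective
  simp [shear_apply, Prod.ext_iff]

theorem shear_neg_shear (B : H →L[ℂ] H) (p : Hhat H) : shear (-B) (shear B p) = p := by
  simpa using shear_shear_neg (-B) p

/-- The shear along `B` as an automorphism of `Ĥ`. -/
def shearEquiv (B : H →L[ℂ] H) : Hhat H ≃L[ℂ] Hhat H :=
  ContinuousLinearEquiv.equivOfInverse (shear B) (shear (-B)) (shear_neg_shear B)
    (shear_shear_neg B)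

/-- The left inverse `(x, y) ↦ (x + i y) / 2` common to all the embeddings `cayleyEmbedding V`. -/
def cayleyRetraction : Hhat H →L[ℂ] H :=
  (2⁻¹ : ℂ) • (WithLp.fstL 2 ℂ H H + Complex.I • WithLp.sndL 2 ℂ H H)

theorem cayleyRetraction_cayleyEmbedding (V : H →L[ℂ] H) (v : H) :
    cayleyRetraction (cayleyEmbedding V v) = v := by
  change (2⁻¹ : ℂ) • (v + V v + Complex.I • -(Complex.I • (v - V v))) = v
  rw [smul_neg, smul_smul, Complex.I_mul_I]
  module

/-- The image of the Cayley graph of `V` under the shear along `B`. -/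
def shearedCayleyGraph (B V : H →L[ℂ] H) : Submodule ℂ (Hhat H) :=
  (cayleyGraph V).map (shearEquiv B : Hhat H →ₗ[ℂ] Hhat H)

theorem shearedCayleyGraph_eq_range (B V : H →L[ℂ] H) :
    shearedCayleyGraph B V =
      LinearMap.range ((shear B ∘L cayleyEmbedding V : H →L[ℂ] Hhat H) : H →ₗ[ℂ] Hhat H) :=
  (LinearMap.range_comp _ _).symm

theorem shearedCayleyGraph_zero (V : H →L[ℂ] H) : shearedCayleyGraph 0 V = cayleyGraph V := by
  have : (shearEquiv (0 : H →L[ℂ] H) : Hhat H →ₗ[ℂ] Hhat H) = LinearMap.id := by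
    ext p
    exact (shear_apply 0 p).trans (by simp; rfl)
  rw [shearedCayleyGraph, this, Submodule.map_id]

theorem mem_shearedCayleyGraph {B V : H →L[ℂ] H} {p : Hhat H} :
    p ∈ shearedCayleyGraph B V ↔ WithLp.toLp 2 (p.fst, p.snd - B p.fst) ∈ cayleyGraph V := by
  rw [shearedCayleyGraph, Submodule.mem_map_equiv]
  change shear (-B) p ∈ _ ↔ _
  rw [shear_apply, sub_eq_add_neg]
  rfl

/-- `cayleyEmbedding V` as an affine function of `V`. -/
theorem cayleyEmbedding_eq (V : H →L[ℂ] H) :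
    cayleyEmbedding V = cayleyEmbedding 0 +
      (WithLp.prodContinuousLinearEquiv 2 ℂ H H).symm.toContinuousLinearMap ∘L
        (ContinuousLinearMap.inl ℂ H H + Complex.I • ContinuousLinearMap.inr ℂ H H) ∘L V := by
  ext v
  apply (WithLp.equiv 2 (H × H)).injective
  refine Prod.ext ?_ ?_
  · change v + V v = v + 0 + (V v + Complex.I • 0)
    simp
  · change -(Complex.I • (v - V v)) = -(Complex.I • (v - 0)) + (0 + Complex.I • V v)
    module

theorem continuous_cayleyEmbedding : Continuous fun V : H →L[ℂ] H => cayleyEmbedding V := by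
  rw [funext cayleyEmbedding_eq]
  fun_prop

/-- Shears along self-adjoint operators preserve the symplectic form, hence lagrangians. -/
theorem IsLagrangian.map_shearEquiv [CompleteSpace H] {L : Submodule ℂ (Hhat H)}
    (hL : IsLagrangian H L) {B : H →L[ℂ] H} (hB : IsSelfAdjoint B) :
    IsLagrangian H (L.map (shearEquiv B : Hhat H →ₗ[ℂ] Hhat H)) := by
  rw [isLagrangian_iff_forall_mem_iff] at hL ⊢
  have hBB : ∀ x y, inner ℂ (B x) y = inner ℂ x (B y) := fun x y =>
    (ContinuousLinearMap.isSelfAdjoint_iff_isSymmetric.1 hB) x y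
  have hs : ∀ p q, inner ℂ (J H (shear B p)) (shear B q) = inner ℂ (J H p) q := by
    intro p q
    simp only [inner_J, fst_shear, snd_shear, inner_add_left, inner_add_right, hBB]
    ring
  intro q
  obtain ⟨q, rfl⟩ := (shearEquiv B).surjective q
  have h1 : shearEquiv B q ∈ L.map (shearEquiv B : Hhat H →ₗ[ℂ] Hhat H) ↔ q ∈ L :=
    (shearEquiv B).injective.mem_set_image
  rw [h1, hL]
  constructor
  · rintro h _ ⟨p, hp, rfl⟩
    exact (hs p q).trans (h p hp)
  · intro h p hp
    rw [← hs]
    exact h _ ⟨p, hp, rfl⟩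

theorem isLagrangian_cayleyGraph [CompleteSpace H] {V : H →L[ℂ] H}
    (hV : V ∈ unitary (H →L[ℂ] H)) : IsLagrangian H (cayleyGraph V) := by
  rw [isLagrangian_iff_forall_mem_iff]
  have hVV : ∀ v, V (star V v) = v := fun v => by
    rw [← mul_apply_eq_comp, (Unitary.mem_iff.1 hV).2]; simp
  have hin : ∀ v w, inner ℂ (V v) (V w) = inner ℂ v w := fun v w => by
    rw [← ContinuousLinearMap.adjoint_inner_left, ← ContinuousLinearMap.star_eq_adjoint,
      ← mul_apply_eq_comp, (Unitary.mem_iff.1 hV).1]; simp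
  have hJ : ∀ v q, inner ℂ (J H (cayleyEmbedding V v)) q =
      Complex.I * inner ℂ (v - V v) q.fst - inner ℂ (v + V v) q.snd := by
    intro v q
    rw [inner_J]
    simp only [fst_cayleyEmbedding, snd_cayleyEmbedding, inner_neg_left, inner_smul_left,
      Complex.conj_I]
    ring
  intro q
  constructor
  · rintro ⟨w, rfl⟩ _ ⟨v, rfl⟩
    refine (hJ v _).trans ?_
    change Complex.I * inner ℂ (v - V v) (w + V w) -
      inner ℂ (v + V v) (-(Complex.I • (w - V w))) = 0
    simp only [inner_neg_right, inner_smul_right, inner_add_left, inner_add_right,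
      inner_sub_left, inner_sub_right, hin]
    ring
  · intro h
    have h1 : ∀ v, inner ℂ v (Complex.I • (q.fst - star V q.fst)) =
        inner ℂ v (q.snd + star V q.snd) := by
      intro v
      have := (hJ v q).symm.trans (h _ ⟨v, rfl⟩)
      simp only [inner_add_left, inner_sub_left] at this
      simp only [inner_smul_right, inner_add_right, inner_sub_right,
        ContinuousLinearMap.star_eq_adjoint, ContinuousLinearMap.adjoint_inner_right]
      linear_combination this
    have h2 := congrArg V (ext_inner_left ℂ h1)
    simp only [map_smul, map_sub, map_add, hVV] at h2
    have h3 : V q.snd = Complex.I • (V q.fst - q.fst) - q.snd := by rw [h2]; abel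
    -- the point `v` is forced by `(1 + V) v + i (-i (1 - V) v) = 2 v`
    refine mem_cayleyGraph.2 ⟨(2⁻¹ : ℂ) • (q.fst + Complex.I • q.snd), ?_, ?_⟩
    · simp only [map_smul, map_add, h3, smul_sub, smul_smul, Complex.I_mul_I]
      module
    · simp only [map_smul, map_add, h3, smul_sub, smul_add, smul_smul]
      match_scalars <;> ring_nf <;> simp [Complex.I_sq]

theorem isLagrangian_shearedCayleyGraph [CompleteSpace H] {B V : H →L[ℂ] H}
    (hB : IsSelfAdjoint B) (hV : V ∈ unitary (H →L[ℂ] H)) :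
    IsLagrangian H (shearedCayleyGraph B V) :=
  (isLagrangian_cayleyGraph hV).map_shearEquiv hB

/-- Shears preserve `H⁻`, so they preserve the condition defining `Lag⁻`. -/
theorem IsFredholmPair.map_shearEquiv {L : Submodule ℂ (Hhat H)}
    (hL : IsFredholmPair L (vertical H)) (B : H →L[ℂ] H) :
    IsFredholmPair (L.map (shearEquiv B : Hhat H →ₗ[ℂ] Hhat H)) (vertical H) := by
  have hv : (vertical H).map (shearEquiv B : Hhat H →ₗ[ℂ] Hhat H) = vertical H := by
    ext p
    rw [Submodule.mem_map_equiv]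
    change (shear (-B) p).fst = 0 ↔ p.fst = 0
    rw [fst_shear]
  obtain ⟨h1, h2⟩ := hL
  constructor
  · rw [← hv, ← Submodule.map_inf _ (shearEquiv B).injective]
    infer_instance
  · rw [← hv, ← Submodule.map_sup, Submodule.map_coe]
    exact (shearEquiv B).toHomeomorph.isClosedMap _ h2

theorem mem_arnoldGraph {L : Lag H} {S : L.space →L[ℂ] L.space} {p : Hhat H} :
    p ∈ arnoldGraph L S ↔ ∃ v : L.space, (v : Hhat H) + J H (S v : Hhat H) = p := Iff.rfl

end Shear

/-! ### Extension of operators along an isometric embedding -/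

section Extend

variable {E H : Type*} [NormedAddCommGroup E] [InnerProductSpace ℂ E] [CompleteSpace E]
  [NormedAddCommGroup H] [InnerProductSpace ℂ H] [CompleteSpace H]

/-- The extension to `H` of an operator `M` of `E` along `c : E → H`, for an isometric embedding
`c`: it acts as `M` on the range of `c` and as the identity on the orthogonal complement. -/
def extendAlong (c : E →L[ℂ] H) (M : E →L[ℂ] E) : H →L[ℂ] H :=
  c ∘L M ∘L c.adjoint + (1 - c ∘L c.adjoint)

theorem extendAlong_apply (c : E →L[ℂ] H) (M : E →L[ℂ] E) (v : H) :
    extendAlong c M v = c (M (c.adjoint v)) + (v - c (c.adjoint v)) := rfl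

variable {c : E →L[ℂ] H} (hc : ∀ x, c.adjoint (c x) = x)
include hc

theorem extendAlong_mem_unitary {M : E →L[ℂ] E} (hM : M ∈ unitary (E →L[ℂ] E)) :
    extendAlong c M ∈ unitary (H →L[ℂ] H) := by
  have hstar : ∀ M, star (extendAlong c M) = extendAlong c (star M) := by
    intro M
    simp only [extendAlong, star_add, star_sub, star_one, ContinuousLinearMap.star_eq_adjoint,
      ContinuousLinearMap.adjoint_comp, ContinuousLinearMap.adjoint_adjoint,
      ContinuousLinearMap.comp_assoc]
  have hmul : ∀ M M', extendAlong c M * extendAlong c M' = extendAlong c (M * M') := by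
    intro M M'
    ext v
    simp [extendAlong_apply, hc]
  have hone : extendAlong c 1 = 1 := by
    ext v
    simp [extendAlong_apply]
  rw [Unitary.mem_iff] at hM ⊢
  rw [hstar, hmul, hmul, hM.1, hM.2, hone]
  exact ⟨rfl, rfl⟩

/-- The Cayley graph of `extendAlong c M` in terms of the Cayley graph of `M` in `E ⊕ E`: the
second component lies in the range of `c`. -/
theorem mem_cayleyGraph_extendAlong {M : E →L[ℂ] E} {p : Hhat H} :
    p ∈ cayleyGraph (extendAlong c M) ↔
      ∃ z, c.adjoint p.fst = z + M z ∧ p.snd = -(Complex.I • c (z - M z)) := by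
  rw [mem_cayleyGraph]
  constructor
  · rintro ⟨v, h1, h2⟩
    refine ⟨c.adjoint v, ?_, ?_⟩
    · rw [← h1, extendAlong_apply]
      simp [hc]
    · rw [← h2, extendAlong_apply, map_sub]
      congr 2
      abel
  · rintro ⟨z, h1, h2⟩
    have h3 : c.adjoint ((2⁻¹ : ℂ) • (p.fst - c (c.adjoint p.fst)) + c z) = z := by
      simp [hc]
    refine ⟨(2⁻¹ : ℂ) • (p.fst - c (c.adjoint p.fst)) + c z, ?_, ?_⟩
    · rw [extendAlong_apply, h3, h1, map_add]
      module
    · rw [extendAlong_apply, h3, h2, map_sub]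
      congr 2
      abel

theorem isFredholmPair_cayleyGraph_extendAlong [FiniteDimensional ℂ E] (M : E →L[ℂ] E) :
    IsFredholmPair (cayleyGraph (extendAlong c M)) (vertical H) := by
  constructor
  · let f : E →ₗ[ℂ] Hhat H := (WithLp.prodContinuousLinearEquiv 2 ℂ H H).symm.toLinearMap ∘ₗ
      LinearMap.inr ℂ H H ∘ₗ c.toLinearMap
    have hle : cayleyGraph (extendAlong c M) ⊓ vertical H ≤ LinearMap.range f := by
      rintro p ⟨hp, hp0⟩
      obtain ⟨z, -, h⟩ := (mem_cayleyGraph_extendAlong hc).1 hp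
      refine ⟨-(Complex.I • (z - M z)), (WithLp.equiv 2 (H × H)).injective (Prod.ext ?_ ?_)⟩
      · exact (show p.fst = 0 from hp0).symm
      · refine Eq.trans ?_ h.symm
        change c (-(Complex.I • (z - M z))) = _
        rw [map_neg, map_smul]
    exact Submodule.finiteDimensional_of_le hle
  · -- the sum consists of the `(x, y)` with `c^* x` in the range of `1 + M`
    have hs : ((cayleyGraph (extendAlong c M) ⊔ vertical H : Submodule ℂ (Hhat H)) :
        Set (Hhat H)) = (fun p : Hhat H => c.adjoint p.fst) ⁻¹'
          (LinearMap.range (1 + M : E →L[ℂ] E).toLinearMap : Set E) := by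
      ext p
      rw [SetLike.mem_coe, Submodule.mem_sup]
      constructor
      · rintro ⟨q, hq, r, hr, rfl⟩
        obtain ⟨z, h, -⟩ := (mem_cayleyGraph_extendAlong hc).1 hq
        refine ⟨z, ?_⟩
        have hr0 : r.fst = 0 := hr
        simp [hr0, h]
      · rintro ⟨z, hz⟩
        have hz' : c.adjoint p.fst = z + M z := hz.symm
        refine ⟨WithLp.toLp 2 (p.fst, -(Complex.I • c (z - M z))),
          (mem_cayleyGraph_extendAlong hc).2 ⟨z, hz', rfl⟩,
          WithLp.toLp 2 (0, p.snd + (Complex.I • c (z - M z))), rfl, ?_⟩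
        apply (WithLp.equiv 2 (H × H)).injective
        simp [Prod.ext_iff]
    rw [hs]
    exact (Submodule.closed_of_finiteDimensional _).preimage
      (c.adjoint.continuous.comp (WithLp.fstL 2 ℂ H H).continuous)

end Extend

/-! ### Continuity and smoothness of families of lagrangians given as ranges -/

section Families

variable {X H : Type*} [NormedAddCommGroup X] [InnerProductSpace ℂ X] [CompleteSpace X]
  [NormedAddCommGroup H] [InnerProductSpace ℂ H] [CompleteSpace H]

theorem isUnit_adjoint_comp_self {Y : Type*} [NormedAddCommGroup Y] [InnerProductSpace ℂ Y]
    [CompleteSpace Y] {j : X →L[ℂ] Y} {r : Y →L[ℂ] X} (hr : ∀ v, r (j v) = v) :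
    IsUnit (j.adjoint ∘L j) := by
  have hpos : 0 < ‖r‖₊ ^ 2 + 1 := by positivity
  refine ContinuousLinearMap.isUnit_of_forall_le_norm_inner_map _
    (c := (‖r‖₊ ^ 2 + 1)⁻¹) (inv_pos.2 hpos) fun v => ?_
  have h1 : ‖v‖ ≤ ‖r‖ * ‖j v‖ := by simpa [hr] using r.le_opNorm (j v)
  have h2 : ‖v‖ ^ 2 ≤ (‖r‖ ^ 2 + 1) * ‖j v‖ ^ 2 := by
    have := pow_le_pow_left₀ (norm_nonneg v) h1 2
    nlinarith [sq_nonneg ‖j v‖]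
  have h3 : ‖j v‖ ^ 2 ≤ ‖inner ℂ ((j.adjoint ∘L j) v) v‖ := by
    rw [j.apply_norm_sq_eq_inner_adjoint_left]
    exact Complex.re_le_norm _
  refine le_trans ?_ h3
  push_cast
  rw [← div_eq_mul_inv, div_le_iff₀ (by positivity)]
  linarith

/-- The orthogonal projection onto the range of an operator `j` that has a left inverse is
`j (j^* j)⁻¹ j^*`. -/
theorem starProjection_range {Y : Type*} [NormedAddCommGroup Y] [InnerProductSpace ℂ Y]
    [CompleteSpace Y] {j : X →L[ℂ] Y} {r : Y →L[ℂ] X} (hr : ∀ v, r (j v) = v)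
    {K : Submodule ℂ Y} [K.HasOrthogonalProjection]
    (hK : K = LinearMap.range (j : X →ₗ[ℂ] Y)) :
    K.starProjection = j ∘L Ring.inverse (j.adjoint ∘L j) ∘L j.adjoint := by
  ext u
  apply Submodule.eq_starProjection_of_mem_of_inner_eq_zero
  · rw [hK]
    exact ⟨_, rfl⟩
  · rw [hK]
    rintro _ ⟨v, rfl⟩
    have h := congrArg (fun f : X →L[ℂ] X => f (j.adjoint u))
      (Ring.mul_inverse_cancel _ (isUnit_adjoint_comp_self hr))
    change j.adjoint (j (Ring.inverse (j.adjoint ∘L j) (j.adjoint u))) = j.adjoint u at h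
    rw [ContinuousLinearMap.coe_coe, ← ContinuousLinearMap.adjoint_inner_left, map_sub]
    change inner ℂ (j.adjoint u - j.adjoint (j (Ring.inverse (j.adjoint ∘L j) (j.adjoint u)))) v = 0
    rw [h, sub_self, inner_zero_left]

/-- The reflection in the range of `j` is a norm continuous function of `j`, so a continuous family
of operators with left inverses has a continuous family of ranges. The left inverses need not
depend continuously on the parameter. -/
theorem continuous_lag_of_range {Z : Type*} [TopologicalSpace Z] {F : Z → Lag H}
    {j : Z → X →L[ℂ] Hhat H} (hj : Continuous j) {r : Z → Hhat H →L[ℂ] X}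
    (hr : ∀ z v, r z (j z v) = v)
    (hF : ∀ z, (F z).space = LinearMap.range (j z : X →ₗ[ℂ] Hhat H)) : Continuous F := by
  rw [continuous_induced_rng]
  have h : Lag.refl ∘ F = fun z => (2 : ℂ) • (j z ∘L Ring.inverse ((j z).adjoint ∘L j z) ∘L
      (j z).adjoint) - ContinuousLinearMap.id ℂ (Hhat H) := by
    funext z
    rw [Function.comp_apply, Lag.refl, starProjection_range (hr z) (hF z)]
  rw [h]
  have hadj : Continuous fun z => (j z).adjoint :=
    (ContinuousLinearMap.adjoint (𝕜 := ℂ)).continuous.comp hj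
  have hinv : Continuous fun z => Ring.inverse ((j z).adjoint ∘L j z) := by
    rw [continuous_iff_continuousAt]
    intro z
    obtain ⟨u, hu⟩ := isUnit_adjoint_comp_self (hr z)
    have h1 : ContinuousAt Ring.inverse ((j z).adjoint ∘L j z) :=
      hu ▸ NormedRing.inverse_continuousAt u
    exact ContinuousAt.comp (f := fun z => (j z).adjoint ∘L j z) h1
      (hadj.clm_comp hj).continuousAt
  exact ((hj.clm_comp (hinv.clm_comp hadj)).const_smul (2 : ℂ)).sub continuous_const

/-- The component in `L` of a point of `Ĥ`, for the decomposition `Ĥ = L ⊕ J L`. -/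
def Lag.proj (L : Lag H) : Hhat H →L[ℂ] L.space := L.space.orthogonalProjectionOnto

/-- The component in `J L` of a point of `Ĥ`, for the decomposition `Ĥ = L ⊕ J L`, carried back
to `L` by `J⁻¹ = -J`. -/
def Lag.coproj (L : Lag H) : Hhat H →L[ℂ] L.space := -(L.proj ∘L J H)

theorem Lag.proj_coe (L : Lag H) (v : L.space) : L.proj v = v :=
  Submodule.orthogonalProjectionOnto_mem_subspace_eq_self v

theorem Lag.proj_J (L : Lag H) (v : L.space) : L.proj (J H (v : Hhat H)) = 0 := by
  rw [Lag.proj, Submodule.orthogonalProjectionOnto_eq_zero_iff]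
  have h : L.space.map (J H : Hhat H →ₗ[ℂ] Hhat H) = L.spaceᗮ := L.2
  rw [← h]
  exact ⟨v, v.2, rfl⟩

theorem Lag.proj_add (L : Lag H) (v w : L.space) :
    L.proj ((v : Hhat H) + J H (w : Hhat H)) = v := by
  rw [map_add, L.proj_coe, L.proj_J, add_zero]

theorem Lag.coproj_add (L : Lag H) (v w : L.space) :
    L.coproj ((v : Hhat H) + J H (w : Hhat H)) = w := by
  change -(L.proj (J H _)) = w
  rw [map_add, map_add, L.proj_J, J_J, map_neg, L.proj_coe, zero_add, neg_neg]

/-- If the range of `j` lies in the Arnold chart around `L`, then the coordinate of that range is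
`b a⁻¹`, where `a` and `b` are the components of `j` for the decomposition `Ĥ = L ⊕ J L`. -/
theorem isInvertible_and_eq_of_range_eq_arnoldGraph {L : Lag H} {S : L.space →L[ℂ] L.space}
    {j : X →L[ℂ] Hhat H} (hinj : Function.Injective j)
    (h : LinearMap.range (j : X →ₗ[ℂ] Hhat H) = arnoldGraph L S) :
    (L.proj ∘L j).IsInvertible ∧ (L.coproj ∘L j) ∘L (L.proj ∘L j).inverse = S := by
  have : CompleteSpace L.space := L.isClosed.completeSpace_coe
  have hj : ∀ x, (L.proj (j x) : Hhat H) + J H (S (L.proj (j x)) : Hhat H) = j x := by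
    intro x
    have hx : j x ∈ arnoldGraph L S := h ▸ ⟨x, rfl⟩
    obtain ⟨v, hv⟩ := mem_arnoldGraph.1 hx
    rw [← hv, L.proj_add]
  have hker : LinearMap.ker (L.proj ∘L j : X →L[ℂ] L.space).toLinearMap = ⊥ := by
    rw [LinearMap.ker_eq_bot]
    intro x y hxy
    have hxy' : L.proj (j x) = L.proj (j y) := hxy
    apply hinj
    rw [← hj x, ← hj y, hxy']
  have hrange : LinearMap.range (L.proj ∘L j : X →L[ℂ] L.space).toLinearMap = ⊤ := by
    rw [LinearMap.range_eq_top]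
    intro v
    have hv : (v : Hhat H) + J H (S v : Hhat H) ∈ LinearMap.range (j : X →ₗ[ℂ] Hhat H) :=
      h ▸ mem_arnoldGraph.2 ⟨v, rfl⟩
    obtain ⟨x, hx⟩ := hv
    refine ⟨x, ?_⟩
    change L.proj (j x) = v
    rw [show j x = _ from hx, L.proj_add]
  let e := ContinuousLinearEquiv.ofBijective (L.proj ∘L j) hker hrange
  have he : (e : X →L[ℂ] L.space) = L.proj ∘L j :=
    ContinuousLinearEquiv.coe_ofBijective _ hker hrange
  refine ⟨⟨e, he⟩, ?_⟩
  rw [← he, ContinuousLinearMap.inverse_equiv]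
  ext1 v
  obtain ⟨x, rfl⟩ := e.surjective v
  have hx : e x = L.proj (j x) := congrArg (fun f : X →L[ℂ] L.space => f x) he
  change L.coproj (j (e.symm (e x))) = S (e x)
  rw [e.symm_apply_apply, hx, ← hj x, L.coproj_add, L.proj_add]

/-- Composition of complex linear operators preserves smoothness over the reals. -/
theorem _root_.ContDiffAt.complex_clm_comp {V E₁ E₂ E₃ : Type*} [NormedAddCommGroup V]
    [NormedSpace ℝ V] [NormedAddCommGroup E₁] [NormedSpace ℂ E₁] [NormedAddCommGroup E₂]
    [NormedSpace ℂ E₂] [NormedAddCommGroup E₃] [NormedSpace ℂ E₃] {n : WithTop ℕ∞}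
    {f : V → E₂ →L[ℂ] E₃} {g : V → E₁ →L[ℂ] E₂} {x : V} (hf : ContDiffAt ℝ n f x)
    (hg : ContDiffAt ℝ n g x) : ContDiffAt ℝ n (fun y => f y ∘L g y) x :=
  ((isBoundedBilinearMap_comp (𝕜 := ℂ) (E := E₁) (F := E₂) (G := E₃)).contDiff.restrict_scalars
    ℝ).contDiffAt.comp x (hf.prodMk hg)

/-- In Arnold charts, the range of `j` has the coordinate `b a⁻¹` of
`isInvertible_and_eq_of_range_eq_arnoldGraph`, so it depends smoothly on `j`. -/
theorem isSmoothFamily_of_range {E : Type*} [NormedAddCommGroup E] [InnerProductSpace ℂ E]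
    [CompleteSpace E] {F : unitary (E →L[ℂ] E) → Lag H} (hF : Continuous F)
    {j : unitary (E →L[ℂ] E) → X →L[ℂ] Hhat H} (hinj : ∀ U, Function.Injective (j U))
    (hrange : ∀ U, (F U).space = LinearMap.range (j U : X →ₗ[ℂ] Hhat H))
    (hj : ∀ U₀, ContDiff ℝ ∞ fun A : Sym E => j (cayleyChart U₀ A)) :
    IsSmoothFamily F := by
  refine ⟨hF, fun U₀ L₀ => ?_⟩
  refine ⟨fun A => (L₀.coproj ∘L j (cayleyChart U₀ A)) ∘L
    (L₀.proj ∘L j (cayleyChart U₀ A)).inverse, ?_⟩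
  rintro A ⟨S', hS', hA⟩
  have : CompleteSpace L₀.space := L₀.isClosed.completeSpace_coe
  obtain ⟨hinv, hS⟩ := isInvertible_and_eq_of_range_eq_arnoldGraph (hinj _)
    ((hrange (cayleyChart U₀ A)).symm.trans hA)
  refine ⟨by beta_reduce; rwa [hS], by beta_reduce; rwa [hS], ?_⟩
  have hjA := (hj U₀).contDiffAt (x := A)
  have hi : ContDiffAt ℝ ∞ ContinuousLinearMap.inverse (L₀.proj ∘L j (cayleyChart U₀ A)) :=
    (hinv.contDiffAt_map_inverse (n := ∞)).restrict_scalars ℝ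
  exact (contDiffAt_const.complex_clm_comp hjA).complex_clm_comp
    (ContDiffAt.comp A (f := fun A => L₀.proj ∘L j (cayleyChart U₀ A)) hi
      (contDiffAt_const.complex_clm_comp hjA))

end Families

/-! ### Blaschke factors of unitary operators -/

section Blaschke

variable {E : Type*} [NormedAddCommGroup E] [InnerProductSpace ℂ E]

/-- The value `(U - s) (s U - 1)⁻¹` at the operator `U` of the Blaschke factor with zero `s`. -/
def blaschke (s : ℝ) (U : E →L[ℂ] E) : E →L[ℂ] E :=
  (U - (s : ℂ) • 1) * Ring.inverse ((s : ℂ) • U - 1)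

theorem blaschke_zero (U : E →L[ℂ] E) : blaschke 0 U = -U := by
  have h : Ring.inverse (-1 : E →L[ℂ] E) = -1 := by
    simpa using Ring.inverse_unit (-1 : (E →L[ℂ] E)ˣ)
  simp [blaschke, h]

/-- A path of continuous self-maps of the unitary group, from the Blaschke factor with zero `1/3`
at `p = 0` to the identity at `p = 1`: the zero moves to `0`, where the Blaschke factor is `-U`,
while a phase makes up for the sign. -/
def blaschkePath (p : ℝ) (U : E →L[ℂ] E) : E →L[ℂ] E :=
  Complex.exp ((Real.pi * p : ℝ) * Complex.I) • blaschke ((1 - p) / 3) U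

theorem blaschkePath_zero (U : E →L[ℂ] E) : blaschkePath 0 U = blaschke (1 / 3) U := by
  simp [blaschkePath]

theorem blaschkePath_one (U : E →L[ℂ] E) : blaschkePath 1 U = U := by
  simp [blaschkePath, blaschke_zero]

theorem abs_one_sub_div_three_lt_one {p : ℝ} (hp : p ∈ unitInterval) : |(1 - p) / 3| < 1 := by
  obtain ⟨h0, h1⟩ := hp
  rw [abs_lt]
  constructor <;> linarith

variable [CompleteSpace E]

theorem isUnit_smul_sub_one {s : ℝ} (hs : |s| < 1) {U : E →L[ℂ] E}
    (hU : U ∈ unitary (E →L[ℂ] E)) : IsUnit ((s : ℂ) • U - 1) := by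
  rw [← neg_sub]
  refine (isUnit_one_sub_of_norm_lt_one ?_).neg
  rw [norm_smul, Complex.norm_real, Real.norm_eq_abs]
  rcases subsingleton_or_nontrivial (E →L[ℂ] E) with h | h
  · rw [Subsingleton.elim U 0, norm_zero, mul_zero]
    exact one_pos
  · rwa [CStarRing.norm_of_mem_unitary hU, mul_one]

theorem blaschke_apply {s : ℝ} (hs : |s| < 1) {U : E →L[ℂ] E} (hU : U ∈ unitary (E →L[ℂ] E))
    (x : E) : blaschke s U ((s : ℂ) • U x - x) = U x - (s : ℂ) • x := by
  have h : blaschke s U * ((s : ℂ) • U - 1) = U - (s : ℂ) • 1 := by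
    rw [blaschke, mul_assoc, Ring.inverse_mul_cancel _ (isUnit_smul_sub_one hs hU), mul_one]
  exact congrArg (fun f : E →L[ℂ] E => f x) h

/-- With `w = s U - 1`, which is normal, `blaschke s U = -U w^* w⁻¹` is a product of unitaries. -/
theorem blaschke_mem_unitary {s : ℝ} (hs : |s| < 1) {U : E →L[ℂ] E}
    (hU : U ∈ unitary (E →L[ℂ] E)) : blaschke s U ∈ unitary (E →L[ℂ] E) := by
  obtain ⟨w, hw⟩ := isUnit_smul_sub_one hs hU
  have hU' := Unitary.mem_iff.1 hU
  have hstar : star (w : E →L[ℂ] E) = (s : ℂ) • star U - 1 := by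
    rw [hw, star_sub, star_smul, star_one]
    simp
  have hnum : U - (s : ℂ) • 1 = -(U * star (w : E →L[ℂ] E)) := by
    rw [hstar, mul_sub, mul_smul_comm, hU'.2, mul_one, neg_sub]
  have hcomm : star w * w = w * star w := by
    ext1
    rw [Units.val_mul, Units.val_mul, Units.coe_star, hstar, hw]
    simp only [mul_sub, sub_mul, mul_smul_comm, smul_mul_assoc, hU'.1, hU'.2, mul_one, one_mul]
    module
  have hq : ((star w * w⁻¹ : (E →L[ℂ] E)ˣ) : E →L[ℂ] E) ∈ unitary (E →L[ℂ] E) := by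
    rw [Unitary.mem_iff, ← Units.coe_star, ← Units.val_mul, ← Units.val_mul, ← Units.val_one,
      Units.val_inj, Units.val_inj, star_mul, star_star, star_inv]
    have h1 : (star w)⁻¹ * w = w * (star w)⁻¹ := by
      rw [inv_mul_eq_iff_eq_mul, ← mul_assoc, hcomm, mul_inv_cancel_right]
    constructor
    · rw [h1]; group
    · rw [h1, mul_assoc, ← mul_assoc w⁻¹]; group
  have h : blaschke s U = -(U * ((star w * w⁻¹ : (E →L[ℂ] E)ˣ) : E →L[ℂ] E)) := by
    rw [blaschke, ← hw, hnum, Ring.inverse_unit, Units.val_mul, Units.coe_star, neg_mul,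
      mul_assoc]
  rw [h, Unitary.mem_iff, star_neg, neg_mul_neg, neg_mul_neg, ← Unitary.mem_iff]
  exact mul_mem hU hq

theorem blaschkePath_mem_unitary {p : ℝ} (hp : p ∈ unitInterval) {U : E →L[ℂ] E}
    (hU : U ∈ unitary (E →L[ℂ] E)) : blaschkePath p U ∈ unitary (E →L[ℂ] E) := by
  have h := Unitary.mem_iff.1 (blaschke_mem_unitary (abs_one_sub_div_three_lt_one hp) hU)
  have he : star (Complex.exp ((Real.pi * p : ℝ) * Complex.I)) *
      Complex.exp ((Real.pi * p : ℝ) * Complex.I) = 1 := by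
    rw [Complex.star_def, ← Complex.normSq_eq_conj_mul_self, Complex.normSq_eq_norm_sq,
      Complex.norm_exp_ofReal_mul_I]
    simp
  rw [Unitary.mem_iff, blaschkePath, star_smul, smul_mul_smul_comm, smul_mul_smul_comm, h.1, h.2,
    mul_comm (Complex.exp _), he, one_smul]
  exact ⟨rfl, rfl⟩

theorem continuous_blaschkePath :
    Continuous fun z : unitInterval × unitary (E →L[ℂ] E) =>
      blaschkePath (z.1 : ℝ) (z.2 : E →L[ℂ] E) := by
  have hden : Continuous fun z : unitInterval × unitary (E →L[ℂ] E) =>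
      Ring.inverse ((((1 - (z.1 : ℝ)) / 3 : ℝ) : ℂ) • (z.2 : E →L[ℂ] E) - 1) := by
    rw [continuous_iff_continuousAt]
    intro z
    obtain ⟨w, hw⟩ := isUnit_smul_sub_one (abs_one_sub_div_three_lt_one z.1.2) z.2.2
    refine ContinuousAt.comp (g := Ring.inverse) (hw ▸ NormedRing.inverse_continuousAt w) ?_
    exact Continuous.continuousAt (by fun_prop)
  unfold blaschkePath blaschke
  fun_prop

theorem contDiff_coe_cayleyChart (U₀ : unitary (E →L[ℂ] E)) :
    ContDiff ℝ ∞ fun A : Sym E => (cayleyChart U₀ A : E →L[ℂ] E) := by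
  have hA : ContDiff ℝ ∞ fun A : Sym E => (A : E →L[ℂ] E) := (Sym E).subtypeL.contDiff
  have hinv : ContDiff ℝ ∞ fun A : Sym E =>
      Ring.inverse (algebraMap ℂ (E →L[ℂ] E) Complex.I + (A : E →L[ℂ] E)) := by
    rw [contDiff_iff_contDiffAt]
    intro A
    obtain ⟨w, hw⟩ := isUnit_I_add A.2
    refine ContDiffAt.comp A (g := Ring.inverse) ?_ (contDiff_const.add hA).contDiffAt
    exact hw ▸ contDiffAt_ringInverse ℝ w
  exact ((contDiff_const.sub hA).mul hinv).mul contDiff_const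

theorem contDiff_blaschke_cayleyChart {s : ℝ} (hs : |s| < 1) (U₀ : unitary (E →L[ℂ] E)) :
    ContDiff ℝ ∞ fun A : Sym E => blaschke s (cayleyChart U₀ A : E →L[ℂ] E) := by
  have hU := contDiff_coe_cayleyChart U₀
  have hinv : ContDiff ℝ ∞ fun A : Sym E =>
      Ring.inverse ((s : ℂ) • (cayleyChart U₀ A : E →L[ℂ] E) - 1) := by
    rw [contDiff_iff_contDiffAt]
    intro A
    obtain ⟨w, hw⟩ := isUnit_smul_sub_one hs (cayleyChart U₀ A).2
    refine ContDiffAt.comp A (g := Ring.inverse) ?_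
      ((hU.const_smul (s : ℂ)).sub contDiff_const).contDiffAt
    exact hw ▸ contDiffAt_ringInverse ℝ w
  exact (hU.sub contDiff_const).mul hinv

end Blaschke

/-! ### Families of sheared Cayley graphs -/

section ShearedFamilies

variable {E H : Type*} [NormedAddCommGroup E] [InnerProductSpace ℂ E] [CompleteSpace E]
  [NormedAddCommGroup H] [InnerProductSpace ℂ H] [CompleteSpace H]

theorem continuous_shear : Continuous fun B : H →L[ℂ] H => shear B := by
  unfold shear
  fun_prop

theorem continuous_extendAlong (c : E →L[ℂ] H) :
    Continuous fun M : E →L[ℂ] E => extendAlong c M := by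
  unfold extendAlong
  fun_prop

theorem contDiff_shear_comp_cayleyEmbedding {W : Type*} [NormedAddCommGroup W] [NormedSpace ℝ W]
    {c : E →L[ℂ] H} {M : W → E →L[ℂ] E} (hM : ContDiff ℝ ∞ M) (B : H →L[ℂ] H) :
    ContDiff ℝ ∞ fun w => shear B ∘L cayleyEmbedding (extendAlong c (M w)) := by
  rw [contDiff_iff_contDiffAt]
  intro w
  rw [funext fun w => congrArg (fun e => shear B ∘L e) (cayleyEmbedding_eq (extendAlong c (M w)))]
  exact contDiffAt_const.complex_clm_comp (contDiffAt_const.add (contDiffAt_const.complex_clm_comp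
    (contDiffAt_const.complex_clm_comp ((contDiffAt_const.complex_clm_comp
      (hM.contDiffAt.complex_clm_comp contDiffAt_const)).add contDiffAt_const))))

/-- An embedding of `H` in `Ĥ` whose range is the sheared Cayley graph of `extendAlong c M`. It is
the parametrization from which continuity and smoothness of the graph are read off. -/
def shearedEmbedding (c : E →L[ℂ] H) (B : H →L[ℂ] H) (M : E →L[ℂ] E) : H →L[ℂ] Hhat H :=
  shear B ∘L cayleyEmbedding (extendAlong c M)

theorem shearedEmbedding_leftInverse (c : E →L[ℂ] H) (B : H →L[ℂ] H) (M : E →L[ℂ] E) (v : H) :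
    (cayleyRetraction ∘L shear (-B)) (shearedEmbedding c B M v) = v :=
  (congrArg cayleyRetraction (shear_neg_shear B _)).trans (cayleyRetraction_cayleyEmbedding _ v)

variable [FiniteDimensional ℂ E]

/-- The sheared Cayley graph of the extension along `c` of a unitary operator of `E`, as a point of
`Lag⁻`. -/
def shearedLag {c : E →L[ℂ] H} (hc : ∀ x, c.adjoint (c x) = x) (B : selfAdjoint (H →L[ℂ] H))
    (M : unitary (E →L[ℂ] E)) : LagMinus H :=
  ⟨⟨shearedCayleyGraph B (extendAlong c M),
    isLagrangian_shearedCayleyGraph B.2 (extendAlong_mem_unitary hc M.2)⟩,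
    (isFredholmPair_cayleyGraph_extendAlong hc (M : E →L[ℂ] E)).map_shearEquiv B⟩

theorem shearedLag_space {c : E →L[ℂ] H} (hc : ∀ x, c.adjoint (c x) = x)
    (B : selfAdjoint (H →L[ℂ] H)) (M : unitary (E →L[ℂ] E)) :
    (shearedLag hc B M).1.space = shearedCayleyGraph (B : H →L[ℂ] H) (extendAlong c M) := rfl

theorem shearedLag_space_eq_range {c : E →L[ℂ] H} (hc : ∀ x, c.adjoint (c x) = x)
    (B : selfAdjoint (H →L[ℂ] H)) (M : unitary (E →L[ℂ] E)) :
    (shearedLag hc B M).1.space =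
      LinearMap.range (shearedEmbedding c (B : H →L[ℂ] H) M : H →ₗ[ℂ] Hhat H) :=
  (shearedLag_space hc B M).trans (shearedCayleyGraph_eq_range _ _)

-- unfolding these definitions makes unification in the remaining proofs intractable
attribute [irreducible] shearedLag shearedEmbedding

theorem continuous_shearedLag {Z : Type*} [TopologicalSpace Z] {c : E →L[ℂ] H}
    (hc : ∀ x, c.adjoint (c x) = x) {B : Z → selfAdjoint (H →L[ℂ] H)}
    {M : Z → unitary (E →L[ℂ] E)} (hB : Continuous B) (hM : Continuous M) :
    Continuous fun z => shearedLag hc (B z) (M z) := by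
  have hj : Continuous fun z => shearedEmbedding c (B z : H →L[ℂ] H) (M z : E →L[ℂ] E) := by
    unfold shearedEmbedding
    exact (continuous_shear.comp (continuous_subtype_val.comp hB)).clm_comp
      (continuous_cayleyEmbedding.comp ((continuous_extendAlong c).comp
        (continuous_subtype_val.comp hM)))
  refine Topology.IsInducing.subtypeVal.continuous_iff.2 ?_
  exact continuous_lag_of_range (F := fun z => (shearedLag hc (B z) (M z)).1) hj
    (fun z => shearedEmbedding_leftInverse c (B z) (M z))
    fun z => shearedLag_space_eq_range hc (B z) (M z)

theorem isSmoothFamily_shearedLag {c : E →L[ℂ] H} (hc : ∀ x, c.adjoint (c x) = x)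
    (B : selfAdjoint (H →L[ℂ] H)) {m : unitary (E →L[ℂ] E) → unitary (E →L[ℂ] E)}
    (hm : Continuous m)
    (hm' : ∀ U₀, ContDiff ℝ ∞ fun A : Sym E => (m (cayleyChart U₀ A) : E →L[ℂ] E)) :
    IsSmoothFamily fun U => (shearedLag hc B (m U)).1 := by
  have hcont := continuous_shearedLag hc (continuous_const (y := B)) hm
  refine isSmoothFamily_of_range (continuous_subtype_val.comp hcont)
    (j := fun U => shearedEmbedding c (B : H →L[ℂ] H) (m U : E →L[ℂ] E))
    (fun _ => Function.LeftInverse.injective (shearedEmbedding_leftInverse _ _ _))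
    (fun U => shearedLag_space_eq_range hc B (m U)) fun U₀ => ?_
  unfold shearedEmbedding
  exact contDiff_shear_comp_cayleyEmbedding (hm' U₀) _

end ShearedFamilies

/-! ### Primitives of square integrable functions -/

section Primitive

variable {N : ℕ}

instance : IsProbabilityMeasure leb := ⟨by simp⟩

theorem integrable_coeFn (h : L2 N) : Integrable h leb :=
  (Lp.memLp h).integrable one_le_two

/-- Primitives with respect to `leb` are defined and continuous on all of `ℝ`; on `[0,1]` they are
the usual ones. -/
theorem intervalIntegral_leb (f : ℝ → CN N) {t : ℝ} (ht : t ∈ Set.Icc (0 : ℝ) 1) :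
    ∫ s in (0 : ℝ)..t, f s ∂leb = ∫ s in (0 : ℝ)..t, f s := by
  rw [intervalIntegral.integral_of_le ht.1, intervalIntegral.integral_of_le ht.1,
    Measure.restrict_restrict measurableSet_Ioc, Set.inter_eq_left.2]
  exact fun s hs => ⟨hs.1.le, hs.2.trans ht.2⟩

theorem integral_leb {F : Type*} [NormedAddCommGroup F] [NormedSpace ℝ F] (f : ℝ → F) :
    ∫ s, f s ∂leb = ∫ s in (0 : ℝ)..1, f s := by
  rw [intervalIntegral.integral_of_le zero_le_one, integral_Icc_eq_integral_Ioc]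

theorem continuous_primitive_leb (h : L2 N) :
    Continuous fun t => ∫ s in (0 : ℝ)..t, h s ∂leb :=
  intervalIntegral.continuous_primitive
    (fun _ _ => (integrable_coeFn h).intervalIntegrable) 0

theorem norm_primitive_leb_le (h : L2 N) (t : ℝ) : ‖∫ s in (0 : ℝ)..t, h s ∂leb‖ ≤ ‖h‖ := by
  have h1 : ‖∫ s in (0 : ℝ)..t, h s ∂leb‖ ≤ ∫ s, ‖h s‖ ∂leb :=
    intervalIntegral.norm_integral_le_integral_norm_uIoc.trans
      (setIntegral_le_integral (integrable_coeFn h).norm (.of_forall fun _ => norm_nonneg _))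
  refine h1.trans ?_
  rw [integral_norm_eq_lintegral_enorm (integrable_coeFn h).1, ← eLpNorm_one_eq_lintegral_enorm,
    Lp.norm_def]
  exact ENNReal.toReal_mono (Lp.eLpNorm_ne_top h)
    (eLpNorm_le_eLpNorm_of_exponent_le one_le_two (integrable_coeFn h).1)

theorem memLp_primitive_leb (h : L2 N) :
    MemLp (fun t => ∫ s in (0 : ℝ)..t, h s ∂leb) 2 leb :=
  .of_bound (continuous_primitive_leb h).aestronglyMeasurable ‖h‖
    (.of_forall (norm_primitive_leb_le h))

/-- The Volterra operator `h ↦ (t ↦ ∫₀ᵗ h)` of `L²([0,1]; ℂ^N)`. -/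
def volterra (N : ℕ) : L2 N →L[ℂ] L2 N :=
  LinearMap.mkContinuous
    { toFun := fun h => (memLp_primitive_leb h).toLp
      map_add' := by
        intro h g
        rw [← MemLp.toLp_add]
        congr 1
        funext t
        rw [Pi.add_apply, ← intervalIntegral.integral_add
          (integrable_coeFn h).intervalIntegrable (integrable_coeFn g).intervalIntegrable]
        refine intervalIntegral.integral_congr_ae_restrict (ae_restrict_of_ae ?_)
        exact Lp.coeFn_add h g
      map_smul' := by
        intro a h
        rw [RingHom.id_apply, ← MemLp.toLp_const_smul]
        congr 1
        funext t
        rw [Pi.smul_apply, ← intervalIntegral.integral_smul]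
        refine intervalIntegral.integral_congr_ae_restrict (ae_restrict_of_ae ?_)
        exact Lp.coeFn_smul a h } 1 (by
    intro h
    rw [one_mul]
    refine (Lp.norm_le_of_ae_bound (norm_nonneg h) ?_).trans ?_
    · filter_upwards [(memLp_primitive_leb h).coeFn_toLp] with t ht
      exact ht ▸ norm_primitive_leb_le h t
    · simp [measureUnivNNReal])

theorem volterra_ae_eq {h : L2 N} {f : ℝ → CN N} (hf : h =ᵐ[leb] f) :
    volterra N h =ᵐ[leb] fun t => ∫ s in (0 : ℝ)..t, f s := by
  filter_upwards [(memLp_primitive_leb h).coeFn_toLp, ae_restrict_mem measurableSet_Icc]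
    with t ht ht01
  rw [← intervalIntegral_leb f ht01]
  exact ht.trans (intervalIntegral.integral_congr_ae_restrict (ae_restrict_of_ae hf))

theorem const_ae_eq (x : CN N) : const N x =ᵐ[leb] fun _ => x :=
  Lp.coeFn_const 2 leb x

/-- The adjoint of the inclusion of the constants is the integral. -/
theorem const_adjoint_apply {h : L2 N} {f : ℝ → CN N} (hf : h =ᵐ[leb] f) :
    (const N).adjoint h = ∫ s in (0 : ℝ)..1, f s := by
  rw [← integral_leb, ← integral_congr_ae hf]
  refine ext_inner_left ℂ fun x => ?_
  rw [ContinuousLinearMap.adjoint_inner_right, L2.inner_def, ← integral_inner (integrable_coeFn h)]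
  refine integral_congr_ae ?_
  filter_upwards [const_ae_eq x] with t ht
  rw [ht]

theorem const_adjoint_const (x : CN N) : (const N).adjoint (const N x) = x := by
  rw [const_adjoint_apply (const_ae_eq x)]
  simp

/-- Classes of smooth functions, which are dense in `L²([0,1]; ℂ^N)`. -/
def smoothClasses (N : ℕ) : Set (L2 N) := {h | ∃ f : ℝ → CN N, h =ᵐ[leb] f ∧ ContDiff ℝ ∞ f}

theorem dense_smoothClasses : Dense (smoothClasses N) := by
  refine (Lp.dense_hasCompactSupport_contDiff (E := ℝ) (F := CN N) (μ := leb) (p := 2)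
    ENNReal.ofNat_ne_top).mono ?_
  rintro _ ⟨f, hf, -, hf'⟩
  exact ⟨f, hf, hf'⟩

theorem hasDerivAt_primitive {f : ℝ → CN N} (hf : Continuous f) (t : ℝ) :
    HasDerivAt (fun t => ∫ s in (0 : ℝ)..t, f s) (f t) t :=
  intervalIntegral.integral_hasDerivAt_right (hf.intervalIntegrable _ _)
    (hf.stronglyMeasurableAtFilter _ _) hf.continuousAt

/-- Integration by parts: the real part of the Volterra operator is half the projection onto the
constants. -/
theorem inner_volterra_add (h g : L2 N) :
    inner ℂ (volterra N h) g + inner ℂ h (volterra N g) =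
      inner ℂ ((const N).adjoint h) ((const N).adjoint g) := by
  have key : ∀ h ∈ smoothClasses N, ∀ g ∈ smoothClasses N,
      inner ℂ (volterra N h) g + inner ℂ h (volterra N g) =
      inner ℂ ((const N).adjoint h) ((const N).adjoint g) := by
    rintro h ⟨f, hf, hfs⟩ g ⟨k, hk, hks⟩
    have hfd := hasDerivAt_primitive hfs.continuous
    have hkd := hasDerivAt_primitive hks.continuous
    have hfc : Continuous fun t => ∫ s in (0 : ℝ)..t, f s :=
      continuous_iff_continuousAt.2 fun t => (hfd t).continuousAt
    have hkc : Continuous fun t => ∫ s in (0 : ℝ)..t, k s :=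
      continuous_iff_continuousAt.2 fun t => (hkd t).continuousAt
    have hf' := hfs.continuous
    have hk' := hks.continuous
    rw [const_adjoint_apply hf, const_adjoint_apply hk, L2.inner_def, L2.inner_def,
      ← integral_add (L2.integrable_inner _ _) (L2.integrable_inner _ _)]
    have h1 : ∫ t, (inner ℂ (volterra N h t) (g t) + inner ℂ (h t) (volterra N g t)) ∂leb =
        ∫ t, (inner ℂ (∫ s in (0 : ℝ)..t, f s) (k t) +
          inner ℂ (f t) (∫ s in (0 : ℝ)..t, k s)) ∂leb := by
      refine integral_congr_ae ?_
      filter_upwards [volterra_ae_eq hf, volterra_ae_eq hk, hf, hk] with t h1 h2 h3 h4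
      rw [h1, h2, h3, h4]
    rw [h1, integral_leb, intervalIntegral.integral_eq_sub_of_hasDerivAt
      (fun t _ => (hfd t).inner ℂ (hkd t))]
    · simp
    · exact Continuous.intervalIntegrable (by fun_prop) _ _
  have h2 : ∀ g ∈ smoothClasses N, inner ℂ (volterra N h) g + inner ℂ h (volterra N g) =
      inner ℂ ((const N).adjoint h) ((const N).adjoint g) := fun g hg =>
    congrFun (Continuous.ext_on dense_smoothClasses (f := fun h : L2 N => inner ℂ (volterra N h) g +
      inner ℂ h (volterra N g)) (g := fun h : L2 N => inner ℂ ((const N).adjoint h)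
        ((const N).adjoint g)) (by fun_prop) (by fun_prop) fun h hh => key h hh g hg) h
  exact congrFun (Continuous.ext_on dense_smoothClasses (f := fun g : L2 N =>
    inner ℂ (volterra N h) g + inner ℂ h (volterra N g)) (g := fun g : L2 N =>
      inner ℂ ((const N).adjoint h) ((const N).adjoint g)) (by fun_prop) (by fun_prop) h2) g

/-- A primitive of a square integrable function determines that function. -/
theorem eq_zero_of_volterra_add_const_eq_zero {h : L2 N} {x : CN N}
    (hx : volterra N h + const N x = 0) : h = 0 := by
  have hF : (fun t => ∫ s in (0 : ℝ)..t, h s ∂leb) =ᵐ[leb] fun _ => -x := by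
    have h0 : ⇑(volterra N h + const N x) =ᵐ[leb] 0 := by
      rw [hx]; exact Lp.coeFn_zero _ _ _
    filter_upwards [(memLp_primitive_leb h).coeFn_toLp, const_ae_eq x,
      Lp.coeFn_add (volterra N h) (const N x), h0] with t h1 h2 h3 h4
    rw [h4, Pi.add_apply, h2] at h3
    rw [← h1]
    exact eq_neg_of_add_eq_zero_left h3.symm
  have hF' := Measure.eqOn_Icc_of_ae_eq volume zero_ne_one hF
    (continuous_primitive_leb h).continuousOn continuousOn_const
  have hint : IntervalIntegrable h volume 0 1 := by
    rw [intervalIntegrable_iff_integrableOn_Icc_of_le zero_le_one]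
    exact integrable_coeFn h
  refine Lp.ext (.trans ?_ (Lp.coeFn_zero _ _ _).symm)
  have hIoo : ∀ᵐ t ∂leb, t ∈ Set.Ioo (0 : ℝ) 1 := by
    rw [leb, ← Measure.restrict_congr_set Ioo_ae_eq_Icc]
    exact ae_restrict_mem measurableSet_Ioo
  filter_upwards [ae_restrict_of_ae hint.ae_hasDerivAt_integral, hIoo] with t ht ht01
  have h1 := ht (by rw [Set.uIcc_of_le zero_le_one]; exact Set.Ioo_subset_Icc_self ht01) 0
    Set.left_mem_uIcc
  have h2 : (fun t => ∫ s in (0 : ℝ)..t, h s) =ᶠ[nhds t] fun _ => -x := by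
    filter_upwards [isOpen_Ioo.mem_nhds ht01] with s hs
    rw [← intervalIntegral_leb _ (Set.Ioo_subset_Icc_self hs)]
    exact hF' (Set.Ioo_subset_Icc_self hs)
  exact (h1.congr_of_eventuallyEq h2.symm).unique (hasDerivAt_const t (-x))

/-! ### The graph of the Dirac operator -/

/-- The fundamental theorem of calculus for `f` with `f(1) = U f(0)`: here `p = (f, -i f')`, so that
`i p.2 = f'`, and `x = f(0)`. -/
theorem exists_of_mem_smoothGraph {U : UN N} {p : L2 N × L2 N} (hp : p ∈ smoothGraph U) :
    ∃ x, p.1 = volterra N (Complex.I • p.2) + const N x ∧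
      (const N).adjoint (Complex.I • p.2) = (U : CN N →L[ℂ] CN N) x - x := by
  obtain ⟨f, hf, hU, hp1, hp2⟩ := hp
  have hh : ⇑(Complex.I • p.2) =ᵐ[leb] derivWithin f (Set.Icc 0 1) := by
    filter_upwards [Lp.coeFn_smul Complex.I p.2, hp2] with t h1 h2
    rw [h1, Pi.smul_apply, h2, smul_neg, smul_smul, Complex.I_mul_I, neg_smul, one_smul, neg_neg]
  have hcont : ContinuousOn (derivWithin f (Set.Icc 0 1)) (Set.Icc 0 1) :=
    hf.continuousOn_derivWithin (uniqueDiffOn_Icc zero_lt_one) (by simp)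
  have hFTC : ∀ t ∈ Set.Icc (0 : ℝ) 1,
      ∫ s in (0 : ℝ)..t, derivWithin f (Set.Icc 0 1) s = f t - f 0 := by
    intro t ht
    have hsub : Set.Icc 0 t ⊆ Set.Icc (0 : ℝ) 1 := Set.Icc_subset_Icc_right ht.2
    refine intervalIntegral.integral_eq_sub_of_hasDerivAt_of_le ht.1
      (hf.continuousOn.mono hsub) (fun s hs => ?_)
      ((hcont.mono hsub).intervalIntegrable_of_Icc ht.1)
    have hs' : Set.Icc (0 : ℝ) 1 ∈ nhds s := Icc_mem_nhds hs.1 (hs.2.trans_le ht.2)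
    exact ((hf.differentiableOn (by simp)) s
      (mem_of_mem_nhds hs')).hasDerivWithinAt.hasDerivAt hs'
  refine ⟨f 0, Lp.ext ?_, ?_⟩
  · filter_upwards [hp1, Lp.coeFn_add (volterra N (Complex.I • p.2)) (const N (f 0)),
      volterra_ae_eq hh, const_ae_eq (f 0), ae_restrict_mem measurableSet_Icc]
      with t h1 h2 h3 h4 ht
    rw [h1, h2, Pi.add_apply, h3, h4, hFTC t ht, sub_add_cancel]
  · rw [const_adjoint_apply hh, hFTC 1 (Set.right_mem_Icc.2 zero_le_one), hU]

theorem mem_smoothGraph_of_mem_smoothClasses {U : UN N} {h : L2 N} (hh : h ∈ smoothClasses N)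
    {x : CN N} (hx : (const N).adjoint h = (U : CN N →L[ℂ] CN N) x - x) :
    (volterra N h + const N x, -(Complex.I • h)) ∈ smoothGraph U := by
  obtain ⟨k, hk, hks⟩ := hh
  have hd : ∀ t, HasDerivAt (fun t => (∫ s in (0 : ℝ)..t, k s) + x) (k t) t :=
    fun t => (hasDerivAt_primitive hks.continuous t).add_const x
  refine ⟨fun t => (∫ s in (0 : ℝ)..t, k s) + x, ?_, ?_, ?_, ?_⟩
  · refine ContDiff.contDiffOn (contDiff_infty_iff_deriv.2
      ⟨fun t => (hd t).differentiableAt, ?_⟩)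
    rwa [funext fun t => (hd t).deriv]
  · beta_reduce
    rw [← const_adjoint_apply hk, hx]
    simp
  · filter_upwards [Lp.coeFn_add (volterra N h) (const N x), volterra_ae_eq hk, const_ae_eq x]
      with t h1 h2 h3
    rw [h1, Pi.add_apply, h2, h3]
  · filter_upwards [Lp.coeFn_neg (Complex.I • h), Lp.coeFn_smul Complex.I h, hk,
      ae_restrict_mem measurableSet_Icc] with t h1 h2 h3 ht
    rw [h1, Pi.neg_apply, h2, Pi.smul_apply, h3,
      (hd t).hasDerivWithinAt.derivWithin (uniqueDiffOn_Icc zero_lt_one t ht)]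

/-- The graph of `T_U` consists of the pairs `(f, -i h)` with `f` the primitive of `h` with initial
value some `x`, subject to the boundary condition `∫ h = U x - x`. -/
theorem mem_closure_smoothGraph {U : UN N} {p : L2 N × L2 N} :
    p ∈ (smoothGraph U).topologicalClosure ↔
      ∃ x, p.1 = volterra N (Complex.I • p.2) + const N x ∧
        (const N).adjoint (Complex.I • p.2) = (U : CN N →L[ℂ] CN N) x - x := by
  constructor
  · -- `x` is a continuous function of `p`, so the right-hand side is a closed condition
    intro hp
    have hcl : IsClosed {p : L2 N × L2 N |
        p.1 = volterra N (Complex.I • p.2) +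
          const N ((const N).adjoint (p.1 - volterra N (Complex.I • p.2))) ∧
        (const N).adjoint (Complex.I • p.2) =
          (U : CN N →L[ℂ] CN N) ((const N).adjoint (p.1 - volterra N (Complex.I • p.2))) -
            (const N).adjoint (p.1 - volterra N (Complex.I • p.2))} :=
      (isClosed_eq (by fun_prop) (by fun_prop)).inter (isClosed_eq (by fun_prop) (by fun_prop))
    refine ⟨_, closure_minimal ?_ hcl hp⟩
    intro q hq
    obtain ⟨x, h1, h2⟩ := exists_of_mem_smoothGraph hq
    have hx : (const N).adjoint (q.1 - volterra N (Complex.I • q.2)) = x := by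
      rw [h1, add_sub_cancel_left, const_adjoint_const]
    rw [Set.mem_ofPred_eq, hx]
    exact ⟨h1, h2⟩
  · -- approximate `i p.2` by smooth functions, corrected by constants to have the same integral
    rintro ⟨x, h1, h2⟩
    set h := Complex.I • p.2 with hh
    let g : L2 N → L2 N := fun k => k - const N ((const N).adjoint k - (const N).adjoint h)
    let Φ : L2 N → L2 N × L2 N := fun k => (volterra N (g k) + const N x, -(Complex.I • g k))
    have hg : Continuous g := by fun_prop
    have hΦ : Continuous Φ := by fun_prop
    have hgh : g h = h := by simp [g]
    have hΦh : Φ h = p := by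
      refine Prod.ext ?_ ?_
      · simp only [Φ, hgh, h1]
      · simp only [Φ, hgh]
        simp only [hh, smul_smul, Complex.I_mul_I, neg_smul, one_smul, neg_neg]
    rw [← hΦh]
    refine map_mem_closure hΦ (dense_smoothClasses h) fun k hk => ?_
    refine mem_smoothGraph_of_mem_smoothClasses ?_ ?_
    · obtain ⟨f, hf, hfs⟩ := hk
      refine ⟨fun t => f t - ((const N).adjoint k - (const N).adjoint h), ?_,
        hfs.sub contDiff_const⟩
      filter_upwards [Lp.coeFn_sub k (const N ((const N).adjoint k - (const N).adjoint h)), hf,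
        const_ae_eq ((const N).adjoint k - (const N).adjoint h)] with t h1 h2 h3
      rw [h1, Pi.sub_apply, h2, h3]
    · simp only [g, map_sub, const_adjoint_const]
      rw [← h2]
      abel

theorem mem_switchedGraph_diracOp {U : UN N} {p : Hhat (L2 N)} :
    p ∈ switchedGraph (diracOp U) ↔
      ∃ x, p.snd = volterra N (Complex.I • p.fst) + const N x ∧
        (const N).adjoint (Complex.I • p.fst) = (U : CN N →L[ℂ] CN N) x - x := by
  have hgraph : (diracOp U).graph = (smoothGraph U).topologicalClosure := by
    refine Submodule.toLinearPMap_graph_eq _ fun q hq hq0 => ?_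
    obtain ⟨x, h1, -⟩ := mem_closure_smoothGraph.1 hq
    have h2 := eq_zero_of_volterra_add_const_eq_zero (h1.symm.trans hq0)
    exact (smul_eq_zero_iff_right Complex.I_ne_zero).1 h2
  rw [← mem_closure_smoothGraph (p := (p.snd, p.fst)), ← hgraph, LinearPMap.mem_graph_iff]
  refine exists_congr fun w => ?_
  rw [and_comm, ← Prod.mk.injEq, eq_comm (a := p),
    ← (WithLp.equiv 2 (L2 N × L2 N)).injective.eq_iff]
  rfl

end Primitive

section Universal

variable {N : ℕ}

/-- The self-adjoint operator `i (D - P / 2)`, where `D` is the Volterra operator and `P` is the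
projection onto the constants; it is the inverse of `-i d/dt` with the boundary condition
`f(1) = -f(0)`. -/
def antiperiodicInverse (N : ℕ) : selfAdjoint (L2 N →L[ℂ] L2 N) :=
  ⟨Complex.I • (volterra N - (2⁻¹ : ℂ) • (const N ∘L (const N).adjoint)), by
    rw [selfAdjoint.mem_iff]
    have h : star (volterra N) = const N ∘L (const N).adjoint - volterra N := by
      rw [ContinuousLinearMap.star_eq_adjoint, eq_comm, ContinuousLinearMap.eq_adjoint_iff]
      intro h g
      have := inner_volterra_add h g
      rw [← ContinuousLinearMap.adjoint_inner_left (const N).adjoint,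
        ContinuousLinearMap.adjoint_adjoint] at this
      change inner ℂ (const N ((const N).adjoint h) - volterra N h) g = _
      rw [inner_sub_left, ← this]
      ring
    have hP : star (const N ∘L (const N).adjoint) = const N ∘L (const N).adjoint := by
      rw [ContinuousLinearMap.star_eq_adjoint, ContinuousLinearMap.adjoint_comp,
        ContinuousLinearMap.adjoint_adjoint]
    have h2 : star (2⁻¹ : ℂ) = 2⁻¹ := by simp
    rw [star_smul, star_sub, star_smul, h, hP, h2, Complex.star_def, Complex.conj_I]
    module⟩

theorem antiperiodicInverse_apply (h : L2 N) :
    (antiperiodicInverse N : L2 N →L[ℂ] L2 N) h =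
      Complex.I • (volterra N h - (2⁻¹ : ℂ) • const N ((const N).adjoint h)) := rfl

/-- The lagrangian of the Dirac operator with boundary condition `f(1) = U f(0)` is the sheared
Cayley graph of a Blaschke factor of `U`. -/
theorem switchedGraph_diracOp (U : UN N) :
    switchedGraph (diracOp U) = shearedCayleyGraph (antiperiodicInverse N : L2 N →L[ℂ] L2 N)
      (extendAlong (const N) (blaschke (1 / 3) (U : CN N →L[ℂ] CN N))) := by
  have hs : |(1 / 3 : ℝ)| < 1 := by rw [abs_of_pos] <;> norm_num
  have hM := blaschke_apply hs U.2
  set M := blaschke (1 / 3) (U : CN N →L[ℂ] CN N)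
  -- the vectors `z = i (3 - U) x / 4` parametrize the Cayley graph of `M` by the initial value `x`
  have hz : ∀ z : CN N, ∃ x, z = (-(Complex.I * (3 / 4)) : ℂ) •
      (((1 / 3 : ℝ) : ℂ) • (U : CN N →L[ℂ] CN N) x - x) := by
    intro z
    obtain ⟨w, hw⟩ := isUnit_smul_sub_one hs U.2
    have h1 : ∀ y, (((1 / 3 : ℝ) : ℂ) • (U : CN N →L[ℂ] CN N) - 1)
        (((w⁻¹ : (CN N →L[ℂ] CN N)ˣ) : CN N →L[ℂ] CN N) y) = y := fun y => by
      rw [← hw, ← mul_apply_eq_comp, Units.mul_inv]; rfl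
    refine ⟨((w⁻¹ : (CN N →L[ℂ] CN N)ˣ) : CN N →L[ℂ] CN N)
      ((-(Complex.I * (3 / 4)) : ℂ)⁻¹ • z), ?_⟩
    refine Eq.trans ?_ (congrArg (fun y => (-(Complex.I * (3 / 4)) : ℂ) • y) (h1 _).symm)
    rw [smul_smul, mul_inv_cancel₀ (by simp), one_smul]
  ext p
  have hB : p.snd - (antiperiodicInverse N : L2 N →L[ℂ] L2 N) p.fst = p.snd -
      volterra N (Complex.I • p.fst) +
        (2⁻¹ : ℂ) • const N ((const N).adjoint (Complex.I • p.fst)) := by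
    rw [antiperiodicInverse_apply]
    simp only [map_smul]
    module
  rw [mem_switchedGraph_diracOp, mem_shearedCayleyGraph,
    mem_cayleyGraph_extendAlong const_adjoint_const]
  change _ ↔ ∃ z, (const N).adjoint p.fst = _ ∧
    p.snd - (antiperiodicInverse N : L2 N →L[ℂ] L2 N) p.fst = _
  rw [hB]
  have hI : ∀ (y : CN N) w, y = w ↔ Complex.I • y = Complex.I • w := fun y w =>
    (smul_right_injective _ Complex.I_ne_zero).eq_iff.symm
  have hsum : ∀ x : CN N, ∀ z, z = (-(Complex.I * (3 / 4)) : ℂ) •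
      (((1 / 3 : ℝ) : ℂ) • (U : CN N →L[ℂ] CN N) x - x) →
      Complex.I • (z + M z) = (U : CN N →L[ℂ] CN N) x - x ∧
      -(Complex.I • const N (z - M z)) =
        (2⁻¹ : ℂ) • const N ((U : CN N →L[ℂ] CN N) x - x) + const N x := by
    rintro x _ rfl
    rw [map_smul M, hM]
    simp only [map_smul, map_sub]
    push_cast
    constructor <;> match_scalars <;> ring_nf <;> simp only [Complex.I_sq] <;> norm_num
  -- both sides now say that `c^* h = (U - 1) x` and that `p.snd - B p.fst = c ((U + 1) x / 2)`,
  -- for `h = i p.fst`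
  constructor
  · rintro ⟨x, h1, h2⟩
    obtain ⟨z, hz⟩ : ∃ z, z = (-(Complex.I * (3 / 4)) : ℂ) •
      (((1 / 3 : ℝ) : ℂ) • (U : CN N →L[ℂ] CN N) x - x) := ⟨_, rfl⟩
    obtain ⟨h3, h4⟩ := hsum x z hz
    refine ⟨z, ?_, ?_⟩
    · rw [hI, h3, ← map_smul, h2]
    · rw [h4, h2, h1]
      abel
  · rintro ⟨z, h1, h2⟩
    obtain ⟨x, hx⟩ := hz z
    obtain ⟨h3, h4⟩ := hsum x z hx
    have h5 : (const N).adjoint (Complex.I • p.fst) = (U : CN N →L[ℂ] CN N) x - x := by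
      rw [map_smul, h1, h3]
    refine ⟨x, ?_, h5⟩
    rw [h4, h5] at h2
    rw [← sub_eq_iff_eq_add']
    exact add_right_cancel (h2.trans (add_comm _ _))

/-! ### The homotopy -/

/-- The multiple `r B` of a self-adjoint operator `B` by a real number `r`. -/
def scaleSelfAdjoint (r : ℝ) (B : selfAdjoint (L2 N →L[ℂ] L2 N)) : selfAdjoint (L2 N →L[ℂ] L2 N) :=
  ⟨(r : ℂ) • (B : L2 N →L[ℂ] L2 N), by
    rw [selfAdjoint.mem_iff, star_smul, selfAdjoint.star_val_eq, Complex.star_def,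
      Complex.conj_ofReal]⟩

theorem coe_scaleSelfAdjoint (r : ℝ) (B : selfAdjoint (L2 N →L[ℂ] L2 N)) :
    (scaleSelfAdjoint r B : L2 N →L[ℂ] L2 N) = (r : ℂ) • (B : L2 N →L[ℂ] L2 N) := rfl

/-- The homotopy from the universal family to the Arnold inclusion: at time `p` the shear is scaled
by `1 - p`, and the unitary operator is moved along `blaschkePath`. -/
def diracHomotopy (p : unitInterval) (U : UN N) : LagMinus (L2 N) :=
  shearedLag const_adjoint_const (scaleSelfAdjoint (1 - (p : ℝ)) (antiperiodicInverse N))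
    ⟨blaschkePath (p : ℝ) (U : CN N →L[ℂ] CN N), blaschkePath_mem_unitary p.2 U.2⟩

theorem continuous_diracHomotopy :
    Continuous fun z : unitInterval × UN N => diracHomotopy z.1 z.2 := by
  have hr : Continuous fun z : unitInterval × UN N => ((1 - (z.1 : ℝ) : ℝ) : ℂ) :=
    Complex.continuous_ofReal.comp
      (continuous_const.sub (continuous_subtype_val.comp continuous_fst))
  have hB : Continuous fun z : unitInterval × UN N =>
      scaleSelfAdjoint (1 - (z.1 : ℝ)) (antiperiodicInverse N) :=
    (hr.smul (continuous_const (y := (antiperiodicInverse N : L2 N →L[ℂ] L2 N)))).subtype_mk _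
  have hM : Continuous fun z : unitInterval × UN N =>
      (⟨blaschkePath (z.1 : ℝ) (z.2 : CN N →L[ℂ] CN N),
        blaschkePath_mem_unitary z.1.2 z.2.2⟩ : UN N) :=
    continuous_blaschkePath.subtype_mk _
  exact continuous_shearedLag const_adjoint_const hB hM

theorem diracHomotopy_zero_space (U : UN N) :
    (diracHomotopy 0 U).1.space = switchedGraph (diracOp U) := by
  refine (shearedLag_space _ _ _).trans ?_
  rw [switchedGraph_diracOp]
  simp only [coe_scaleSelfAdjoint, Set.Icc.coe_zero, sub_zero, Complex.ofReal_one, one_smul,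
    blaschkePath_zero]

theorem diracHomotopy_one_space (U : UN N) :
    (diracHomotopy 1 U).1.space = cayleyGraph (extendByOne U) := by
  refine (shearedLag_space _ _ _).trans ?_
  simp only [coe_scaleSelfAdjoint, Set.Icc.coe_one, sub_self, Complex.ofReal_zero, zero_smul,
    shearedCayleyGraph_zero, blaschkePath_one]
  rfl

theorem isSmoothFamily_diracHomotopy_zero :
    IsSmoothFamily fun U : UN N => (diracHomotopy 0 U).1 := by
  let m : UN N → UN N := fun U =>
    ⟨blaschkePath ((0 : unitInterval) : ℝ) (U : CN N →L[ℂ] CN N),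
      blaschkePath_mem_unitary (0 : unitInterval).2 U.2⟩
  have hpair : Continuous fun U : UN N => ((0 : unitInterval), U) :=
    continuous_const.prodMk continuous_id
  have hm : Continuous m := (continuous_blaschkePath.comp hpair).subtype_mk _
  have hm' : ∀ U₀, ContDiff ℝ ∞ fun A : Sym (CN N) => (m (cayleyChart U₀ A) : CN N →L[ℂ] CN N) := by
    intro U₀
    have h : ∀ U, (m U : CN N →L[ℂ] CN N) = blaschke (1 / 3) (U : CN N →L[ℂ] CN N) :=
      fun U => blaschkePath_zero _
    simp only [h]
    exact contDiff_blaschke_cayleyChart (by rw [abs_of_pos] <;> norm_num) U₀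
  exact isSmoothFamily_shearedLag const_adjoint_const _ hm hm'

end Universal

end LagGrass

end

open LagGrass in
theorem mainTheorem10 (N : ℕ) :
    ∃ T ι : C(UN N, LagMinus (L2 N)),
      (∀ U : UN N, (T U).1.space = switchedGraph (diracOp U)) ∧
      IsSmoothFamily (fun U : UN N => (T U).1) ∧
      (∀ U : UN N, (ι U).1.space = cayleyGraph (extendByOne U)) ∧
      T.Homotopic ι := by
  let G : C(unitInterval × UN N, LagMinus (L2 N)) := ⟨_, continuous_diracHomotopy⟩
  refine ⟨G.curry 0, G.curry 1, diracHomotopy_zero_space, isSmoothFamily_diracHomotopy_zero,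
    diracHomotopy_one_space, ⟨⟨G, fun _ => rfl, fun _ => rfl⟩⟩⟩
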